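/- Let $\|\cdot\|$ be an arbitrary norm on $\mathbb R^d$, $d\ge 1$, let $\lambda^d$ be Lebesgue measure, $B(x,s)$ and $\overline B(x,s)$ the open and closed balls, and $d(x,A)=\inf_{a\in A}\|x-a\|$. Let $r>0$ and let $P$ be a Borel probability on $\mathbb R^d$ with $\int\|x\|^{r+\delta}\,dP(x)<\infty$ for some $\delta>0$. For each $n\ge 1$ let $\alpha_n$ be an $n$-optimal set of order $r$ for $P$, i.e. $\mathrm{card}(\alpha_n)\le n$ and $\int d(x,\alpha_n)^r\,dP(x)=\inf\{\int d(x,\alpha)^r\,dP(x) : \alpha\subset\mathbb R^d,\ \mathrm{card}(\alpha)\le n\}$. Let $R>0$ and suppose that $P$ has the peakless sublevel tail property outside $\overline B(0,R)$, that is: (i) $P=h\,\lambda^d$ with a Borel measurable, essentially bounded density $h$; (ii) for every $\rho>0$ there is $c_\rho>0$ with $h(x)\ge c_\rho$ for all $x\in\overline B(0,\rho)$; (iii) there are an interval $I\subset\mathbb R$, a Borel measurable $f:\mathbb R^d\to I$ and a non-increasing $g:I\to(0,\infty)$ with $h(x)=g(f(x))$ whenever $\|x\|\ge R$, where $f$ has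 the peakless sublevel property outside $\overline B(0,R)$: there are $s_0,c_f>0$ such that $\lambda^d(\{f\le f(x)\}\cap B(x,s))\ge c_f\,\lambda^d(B(x,s))$ for all $x\in\mathbb R^d\setminus\overline B(0,R)$ and all $s\in(0,s_0)$. Then there is a constant $c_{21}>0$ such that for every compact $K\subset\mathbb R^d$ there is $n_K\in\mathbb N$ such that for all $n\ge n_K$ the inequality $$c_{21}\,n^{-1/d}\,h(x)^{-\frac1{r+d}}\ \ge\ d(x,\alpha_n)$$ holds for $\lambda^d$-almost every $x\in K$; and if the chosen version of $h$ is bounded on $\overline B(0,R)$ (in particular, if $h$ is bounded), it holds for every $x\in K$. -/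

import Mathlib

open MeasureTheory

/-- The `r`-th power distortion `∫ d(x, α)^r dP(x)` of a finite codebook `α`, as an extended
nonnegative number (it is `∞` for the empty codebook and a probability `P`). -/
noncomputable def distortion {E : Type*} [NormedAddCommGroup E] [MeasurableSpace E]
    (P : Measure E) (r : ℝ) (α : Finset E) : ENNReal :=
  ∫⁻ x, (Metric.infEDist x (α : Set E)) ^ r ∂P

/-- The `r`-th power `e_{n,r}^r` of the `n`-th level `L^r(P)`-quantization error: the infimum of
the distortion over all codebooks with at most `n` points. -/
noncomputable def quantErrorPow {E : Type*} [NormedAddCommGroup E] [MeasurableSpace E]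
    (P : Measure E) (r : ℝ) (n : ℕ) : ENNReal :=
  ⨅ (α : Finset E) (_ : α.card ≤ n), distortion P r α

/-- `α` is an `n`-optimal set (codebook) of order `r` for `P`. -/
def IsOptimalCodebook {E : Type*} [NormedAddCommGroup E] [MeasurableSpace E]
    (P : Measure E) (r : ℝ) (n : ℕ) (α : Finset E) : Prop :=
  α.card ≤ n ∧ distortion P r α = quantErrorPow P r n

/-- The peakless sublevel property of `f` outside the closed ball of radius `R`, with respect to
the Lebesgue measure `lam`. -/
def PeaklessSublevel {E : Type*} [NormedAddCommGroup E] [MeasurableSpace E]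
    (lam : Measure E) (R : ℝ) (f : E → ℝ) : Prop :=
  Measurable f ∧
    ∃ s₀ : ℝ, 0 < s₀ ∧ ∃ cf : ℝ, 0 < cf ∧
      ∀ x : E, x ∉ Metric.closedBall (0 : E) R → ∀ s : ℝ, 0 < s → s < s₀ →
        ENNReal.ofReal cf * lam (Metric.ball x s) ≤ lam ({y | f y ≤ f x} ∩ Metric.ball x s)

/-- The peakless sublevel tail property outside the closed ball of radius `R` of the distribution
`P` with density `h` with respect to the Lebesgue measure `lam`. -/
structure PeaklessSublevelTail {E : Type*} [NormedAddCommGroup E] [MeasurableSpace E]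
    (lam P : Measure E) (h : E → ℝ) (R : ℝ) : Prop where
  measurable_density : Measurable h
  density : P = lam.withDensity (fun x => ENNReal.ofReal (h x))
  ess_bounded : ∃ M : ℝ, ∀ᵐ x ∂lam, |h x| ≤ M
  bounded_below : ∀ ρ : ℝ, 0 < ρ → ∃ c : ℝ, 0 < c ∧ ∀ x ∈ Metric.closedBall (0 : E) ρ, c ≤ h x
  tail : ∃ (I : Set ℝ) (f : E → ℝ) (g : ℝ → ℝ),
    I.OrdConnected ∧ (∀ x, f x ∈ I) ∧ PeaklessSublevel lam R f ∧
    AntitoneOn g I ∧ (∀ t ∈ I, 0 < g t) ∧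
    ∀ x : E, R ≤ ‖x‖ → h x = g (f x)

/-! ### Effect on the distortion of adding or removing one codebook point. -/

section Distortion

variable {E : Type*} [NormedAddCommGroup E] [MeasurableSpace E]

/-! Write `e_n` for `quantErrorPow P r n`, `D` for the distance from `x` to `α n`, and `ν = n ^
(-1/d)`. The increment `e_n - e_{n+1}` is bounded from both sides.

Lower bound: adding `x` to `α n` saves at least a multiple of `D ^ r * P (ball x (D / 4))`. The
peakless property makes the mass of small balls at least a multiple of `h x` times their volume
(`PeaklessSublevelTail.le_measure_ball`), so the saving is at least a multiple of `D ^ (r + d) * h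
x`.

Upper bound (`quantErrorPow_le_succ_add`): some point of `α (n + 1)` can be removed at cost `O(ν ^
(r + d))`. The moment condition gives `e_n = O(ν ^ r)`, which forces a multiple of `n` codebook
points near the unit ball. By volume, at least half of that many have a neighbour at distance
`O(ν)`. Their cells are disjoint, so the removal costs sum to `O(ν ^ r)`, and the cheapest is `O(ν ^
r / n)`.

Comparing the two bounds and taking `(r + d)`-th roots gives the claim. -/

theorem quantErrorPow_le {P : Measure E} {r : ℝ} {n : ℕ} {α : Finset E} (hα : α.card ≤ n) :
    quantErrorPow P r n ≤ distortion P r α :=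
  iInf₂_le α hα

theorem ofReal_infDist_eq_infEDist {E : Type*} [NormedAddCommGroup E] {α : Set E} (hα : α.Nonempty) (x : E) :
    ENNReal.ofReal (Metric.infDist x α) = Metric.infEDist x α :=
  ENNReal.ofReal_toReal (Metric.infEDist_ne_top hα)

/-- Adding a point `y` to a codebook decreases the distortion by at least a multiple of
`d(y, α)^r P(B(y, s))` when `s ≤ d(y, α) / 4`. -/
theorem distortion_insert_add_le [BorelSpace E] [DecidableEq E] (P : Measure E) {r : ℝ}
    (hr : 0 < r) {α : Finset E} {y : E} {s : ℝ} (hα : α.Nonempty)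
    (hs : s ≤ Metric.infDist y (α : Set E) / 4) :
    distortion P r (insert y α) +
      ENNReal.ofReal (((3 / 4 : ℝ) ^ r - (1 / 4 : ℝ) ^ r) *
        Metric.infDist y (α : Set E) ^ r) * P (Metric.ball y s) ≤ distortion P r α := by
  set D := Metric.infDist y (α : Set E) with hD
  have hD0 : 0 ≤ D := Metric.infDist_nonneg
  have hr0 : 0 ≤ r := hr.le
  unfold distortion
  rw [← lintegral_indicator_const Metric.isOpen_ball.measurableSet,
    ← lintegral_add_right _ (measurable_const.indicator Metric.isOpen_ball.measurableSet)]
  refine lintegral_mono fun x => ?_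
  by_cases hx : x ∈ Metric.ball y s
  · rw [Set.indicator_of_mem hx]
    have hxy : dist x y ≤ D / 4 := (Metric.mem_ball.1 hx).le.trans hs
    have h1 : Metric.infEDist x ((insert y α : Finset E) : Set E) ≤ ENNReal.ofReal (D / 4) := by
      refine (Metric.infEDist_le_edist_of_mem (by simp)).trans (?_ : edist x y ≤ _)
      rw [edist_dist]
      exact ENNReal.ofReal_le_ofReal hxy
    have h2 : ENNReal.ofReal (3 * D / 4) ≤ Metric.infEDist x (α : Set E) := by
      rw [← ofReal_infDist_eq_infEDist (by simpa using hα)]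
      apply ENNReal.ofReal_le_ofReal
      have := Metric.infDist_le_infDist_add_dist (s := (α : Set E)) (x := y) (y := x)
      rw [dist_comm] at this
      linarith
    refine le_trans ?_ (ENNReal.rpow_le_rpow h2 hr0)
    refine (add_le_add_left (ENNReal.rpow_le_rpow h1 hr0) _).trans ?_
    rw [ENNReal.ofReal_rpow_of_nonneg (by positivity) hr0,
      ENNReal.ofReal_rpow_of_nonneg (by positivity) hr0, ← ENNReal.ofReal_add (by positivity)]
    · apply ENNReal.ofReal_le_ofReal
      rw [show D / 4 = 1 / 4 * D by ring, show 3 * D / 4 = 3 / 4 * D by ring,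
        Real.mul_rpow (by norm_num) hD0, Real.mul_rpow (by norm_num) hD0]
      linarith
    · have : (1 / 4 : ℝ) ^ r ≤ (3 / 4 : ℝ) ^ r :=
        Real.rpow_le_rpow (by norm_num) (by norm_num) hr0
      exact mul_nonneg (by linarith) (by positivity)
  · rw [Set.indicator_of_notMem hx, add_zero]
    exact ENNReal.rpow_le_rpow (Metric.infEDist_anti (by simp)) hr0

/-- Removing the point `a` from a codebook changes the distance function only on the open set of
points that are strictly nearer to `a` than to the other points. -/
theorem distortion_erase_le [BorelSpace E] [DecidableEq E] (P : Measure E) {r : ℝ}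
    (hr : 0 < r) {α : Finset E} {a : E} (ha : a ∈ α) {u : ℝ}
    (hu : Metric.infEDist a (α.erase a : Set E) ≤ ENNReal.ofReal u) :
    distortion P r (α.erase a) ≤ distortion P r α +
      ENNReal.ofReal (2 ^ r) * ∫⁻ x in {x | edist x a < Metric.infEDist x (α.erase a : Set E)},
        (Metric.infEDist x (α : Set E) ^ r + ENNReal.ofReal u ^ r) ∂P := by
  have hins : (α : Set E) = insert a (α.erase a : Set E) := by
    rw [← Finset.coe_insert, Finset.insert_erase ha]
  have hV : MeasurableSet {x | edist x a < Metric.infEDist x (α.erase a : Set E)} :=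
    (isOpen_lt (by fun_prop) Metric.continuous_infEDist).measurableSet
  have hm : Measurable fun x => Metric.infEDist x (α : Set E) ^ r + ENNReal.ofReal u ^ r :=
    (measurable_infEDist.pow_const r).add_const _
  unfold distortion
  rw [← lintegral_indicator hV, ← lintegral_const_mul _ (hm.indicator hV),
    ← lintegral_add_right _ ((hm.indicator hV).const_mul _)]
  refine lintegral_mono fun x => ?_
  by_cases hx : edist x a < Metric.infEDist x (α.erase a : Set E)
  · rw [Set.indicator_of_mem (by exact hx)]
    have h1 : Metric.infEDist x (α : Set E) = edist x a := by
      rw [hins, Set.insert_eq, Metric.infEDist_union, Metric.infEDist_singleton]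
      exact min_eq_left hx.le
    have h2 : Metric.infEDist x (α.erase a : Set E) ≤
        Metric.infEDist x (α : Set E) + ENNReal.ofReal u := by
      rw [h1, add_comm]
      exact Metric.infEDist_le_infEDist_add_edist.trans (add_le_add_left hu _)
    refine le_trans ?_ le_add_self
    refine (ENNReal.rpow_le_rpow h2 hr.le).trans ?_
    generalize Metric.infEDist x (α : Set E) = p
    generalize ENNReal.ofReal u = q
    -- Passing through the maximum avoids convexity and so covers `r < 1` as well.
    calc (p + q) ^ r ≤ (2 * max p q) ^ r := by
          refine ENNReal.rpow_le_rpow ?_ hr.le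
          rw [two_mul]
          exact add_le_add (le_max_left _ _) (le_max_right _ _)
      _ = ENNReal.ofReal (2 ^ r) * max p q ^ r := by
          rw [ENNReal.mul_rpow_of_nonneg _ _ hr.le,
            ← ENNReal.ofReal_rpow_of_nonneg (by norm_num) hr.le]
          norm_num
      _ ≤ _ := by
          gcongr
          rcases max_choice p q with h | h <;> rw [h]
          · exact le_self_add
          · exact le_add_self
  · rw [Set.indicator_of_notMem (by exact hx), mul_zero, add_zero]
    refine ENNReal.rpow_le_rpow ?_ hr.le
    rw [hins, Set.insert_eq, Metric.infEDist_union, Metric.infEDist_singleton]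
    exact le_min (not_lt.1 hx) le_rfl

end Distortion

/-! ### Codebooks with spacing growing like a power of the norm. -/

section Covering

variable {E : Type*} [NormedAddCommGroup E]

/-- Admissible finite subsets of bounded cardinality contain one of maximal cardinality. -/
theorem exists_finset_card_maximal {X : Type*} {Q : Finset X → Prop} (h0 : Q ∅) {N : ℝ}
    (hN : ∀ A, Q A → (A.card : ℝ) ≤ N) : ∃ A, Q A ∧ ∀ B, Q B → B.card ≤ A.card := by
  have hb : BddAbove {k : ℕ | ∃ A, Q A ∧ A.card = k} := by
    refine ⟨⌊N⌋₊, ?_⟩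
    rintro k ⟨A, hA, rfl⟩
    exact Nat.le_floor (hN A hA)
  obtain ⟨A, hA, hk⟩ := Nat.sSup_mem (s := {k : ℕ | ∃ A, Q A ∧ A.card = k}) ⟨0, ∅, h0, rfl⟩ hb
  exact ⟨A, hA, fun B hB => hk ▸ le_csSup hb ⟨B, hB, rfl⟩⟩

/-- Points separated at the scale `ρ x = t (1 + ‖x‖) ^ (1 + θ)` have disjoint balls of radii
proportional to `ρ`. -/
theorem disjoint_balls_of_separated {t θ : ℝ} (ht : 0 < t) (hθ : 0 < θ) {x y : E}
    (hx : t * (1 + ‖x‖) ^ θ ≤ 1) (hy : t * (1 + ‖y‖) ^ θ ≤ 1)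
    (hxy : min (t * (1 + ‖x‖) ^ (1 + θ)) (t * (1 + ‖y‖) ^ (1 + θ)) ≤ dist x y) :
    Disjoint (Metric.ball x ((2 : ℝ) ^ (-(1 + θ)) / 2 * (t * (1 + ‖x‖) ^ (1 + θ))))
      (Metric.ball y ((2 : ℝ) ^ (-(1 + θ)) / 2 * (t * (1 + ‖y‖) ^ (1 + θ)))) := by
  wlog hle : ‖x‖ ≤ ‖y‖ generalizing x y
  · exact (this hy hx (by rwa [min_comm, dist_comm]) (le_of_not_ge hle)).symm
  have hρ : t * (1 + ‖x‖) ^ (1 + θ) ≤ t * (1 + ‖y‖) ^ (1 + θ) := by gcongr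
  rw [min_eq_left hρ] at hxy
  have hρy : t * (1 + ‖y‖) ^ (1 + θ) ≤ 1 + ‖y‖ := by
    rw [Real.rpow_add (by positivity), Real.rpow_one]
    calc t * ((1 + ‖y‖) * (1 + ‖y‖) ^ θ) = (1 + ‖y‖) * (t * (1 + ‖y‖) ^ θ) := by ring
      _ ≤ (1 + ‖y‖) * 1 := by gcongr
      _ = _ := mul_one _
  have hκ : (2 : ℝ) ^ (-(1 + θ)) ≤ 1 / 2 := by
    calc (2 : ℝ) ^ (-(1 + θ)) ≤ (2 : ℝ) ^ (-1 : ℝ) :=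
          Real.rpow_le_rpow_of_exponent_le (by norm_num) (by linarith)
      _ = 1 / 2 := by rw [Real.rpow_neg_one]; norm_num
  refine Metric.ball_disjoint_ball ?_
  -- If the balls were too close, `x` would be within `(1 + ‖y‖) / 2` of `y`. Then `1 + ‖x‖` is at
  -- least half of `1 + ‖y‖`, and the scale at `x` already exceeds the distance.
  by_contra! hlt
  have hpos : 0 < (2 : ℝ) ^ (-(1 + θ)) := by positivity
  have hd : dist x y < (2 : ℝ) ^ (-(1 + θ)) * (t * (1 + ‖y‖) ^ (1 + θ)) := by
    have : (2 : ℝ) ^ (-(1 + θ)) * (t * (1 + ‖x‖) ^ (1 + θ)) ≤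
      (2 : ℝ) ^ (-(1 + θ)) * (t * (1 + ‖y‖) ^ (1 + θ)) := by gcongr
    linarith
  have hρ0 : 0 ≤ t * (1 + ‖y‖) ^ (1 + θ) := by positivity
  have hn : ‖y‖ ≤ ‖x‖ + dist x y := by
    rw [dist_comm, dist_eq_norm]
    have := norm_add_le x (y - x)
    simpa using this
  have hhalf : (1 + ‖y‖) / 2 ≤ 1 + ‖x‖ := by nlinarith [norm_nonneg x, norm_nonneg y]
  have : (2 : ℝ) ^ (-(1 + θ)) * (t * (1 + ‖y‖) ^ (1 + θ)) ≤ t * (1 + ‖x‖) ^ (1 + θ) := by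
    calc (2 : ℝ) ^ (-(1 + θ)) * (t * (1 + ‖y‖) ^ (1 + θ))
        = t * ((1 + ‖y‖) / 2) ^ (1 + θ) := by
          rw [Real.div_rpow (by positivity) (by norm_num), Real.rpow_neg (by norm_num)]
          ring
      _ ≤ _ := by gcongr
  linarith

variable [NormedSpace ℝ E] [FiniteDimensional ℝ E] [MeasurableSpace E]

theorem measure_unit_ball_toReal_pos (lam : Measure E) [lam.IsAddHaarMeasure] :
    0 < (lam (Metric.ball 0 1)).toReal :=
  ENNReal.toReal_pos (Metric.measure_ball_pos lam 0 one_pos).ne' measure_ball_lt_top.ne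

variable [BorelSpace E]

/-- The weight `(1 + ‖x‖) ^ (-d (1 + θ))` is integrable because `θ > 0`. Its decay cancels the
growth of the ball volumes, so each of the disjoint balls carries at least a fixed multiple of `t ^
d` of its integral. -/
theorem card_le_of_separated [Nontrivial E] (lam : Measure E) [lam.IsAddHaarMeasure] {θ : ℝ}
    (hθ : 0 < θ) : ∃ C : ℝ, 0 < C ∧ ∀ t : ℝ, 0 < t → ∀ A : Finset E,
      (∀ x ∈ A, t * (1 + ‖x‖) ^ θ ≤ 1) →
      (∀ x ∈ A, ∀ y ∈ A, x ≠ y →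
        min (t * (1 + ‖x‖) ^ (1 + θ)) (t * (1 + ‖y‖) ^ (1 + θ)) ≤ dist x y) →
      (A.card : ℝ) * t ^ Module.finrank ℝ E ≤ C := by
  set d := Module.finrank ℝ E with hd
  have hd0 : (0 : ℝ) < d := by exact_mod_cast (Module.finrank_pos (R := ℝ) (M := E))
  set w : E → ENNReal := fun x => ENNReal.ofReal ((1 + ‖x‖) ^ (-(d * (1 + θ)))) with hw
  set J := ∫⁻ x : E, w x ∂lam with hJ
  have hJ' : J < ⊤ := finite_integral_one_add_norm (by rw [← hd]; nlinarith)
  set κ : ℝ := (2 : ℝ) ^ (-(1 + θ)) / 2 with hκ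
  have hκ0 : 0 < κ := by positivity
  have hκ1 : κ ≤ 1 := by
    have : (2 : ℝ) ^ (-(1 + θ)) ≤ 1 :=
      Real.rpow_le_one_of_one_le_of_nonpos (by norm_num) (by linarith)
    rw [hκ]; linarith
  set v := lam (Metric.ball (0 : E) 1) with hv
  have hv0 : 0 < v.toReal := measure_unit_ball_toReal_pos lam
  have hvtop : v ≠ ⊤ := measure_ball_lt_top.ne
  set c : ℝ := (2 : ℝ) ^ (-(d * (1 + θ))) * κ ^ d with hc
  have hc0 : 0 < c := by positivity
  refine ⟨(J.toReal + 1) / (c * v.toReal), by positivity, fun t ht A hA hsep => ?_⟩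
  set B : E → Set E := fun x => Metric.ball x (κ * (t * (1 + ‖x‖) ^ (1 + θ))) with hB
  have hlow : ∀ x ∈ A, ENNReal.ofReal (c * t ^ d) * v ≤ ∫⁻ y in B x, w y ∂lam := by
    intro x hx
    have hρ : t * (1 + ‖x‖) ^ (1 + θ) ≤ 1 + ‖x‖ := by
      rw [Real.rpow_add (by positivity), Real.rpow_one]
      have := mul_le_mul_of_nonneg_left (hA x hx) (by positivity : 0 ≤ 1 + ‖x‖)
      linarith
    calc ENNReal.ofReal (c * t ^ d) * v
        = ∫⁻ y in B x, ENNReal.ofReal ((2 * (1 + ‖x‖)) ^ (-(d * (1 + θ)))) ∂lam := by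
          rw [setLIntegral_const, hB, Measure.addHaar_ball lam x (by positivity), ← mul_assoc,
            ← ENNReal.ofReal_mul (by positivity)]
          congr 2
          have h1 : ((1 + ‖x‖) ^ (1 + θ)) ^ d = (1 + ‖x‖) ^ (d * (1 + θ)) := by
            rw [← Real.rpow_natCast, ← Real.rpow_mul (by positivity), mul_comm]
          have h2 : (1 + ‖x‖) ^ (-(d * (1 + θ))) * (1 + ‖x‖) ^ (d * (1 + θ)) = 1 := by
            rw [← Real.rpow_add (by positivity)]; simp
          rw [← hd, mul_pow, mul_pow, h1, Real.mul_rpow (by norm_num) (by positivity), hc]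
          linear_combination (-((2 : ℝ) ^ (-(d * (1 + θ))) * κ ^ d * t ^ d)) * h2
      _ ≤ ∫⁻ y in B x, w y ∂lam := by
          refine setLIntegral_mono' Metric.isOpen_ball.measurableSet fun y hy => ?_
          refine ENNReal.ofReal_le_ofReal
            (Real.rpow_le_rpow_of_nonpos (by positivity) ?_ (by nlinarith))
          have h1 : dist y x < κ * (t * (1 + ‖x‖) ^ (1 + θ)) := hy
          have h2 : κ * (t * (1 + ‖x‖) ^ (1 + θ)) ≤ 1 * (1 + ‖x‖) := by gcongr
          have h3 : ‖y‖ ≤ ‖x‖ + dist y x := by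
            rw [dist_eq_norm]
            simpa using norm_add_le x (y - x)
          linarith [norm_nonneg x]
  have hsum : (A.card : ENNReal) * (ENNReal.ofReal (c * t ^ d) * v) ≤ J := by
    calc (A.card : ENNReal) * (ENNReal.ofReal (c * t ^ d) * v)
        = ∑ x ∈ A, ENNReal.ofReal (c * t ^ d) * v := by simp
      _ ≤ ∑ x ∈ A, ∫⁻ y in B x, w y ∂lam := Finset.sum_le_sum hlow
      _ = ∫⁻ y in ⋃ x ∈ A, B x, w y ∂lam := by
          refine (lintegral_biUnion_finset ?_ (fun x _ => Metric.isOpen_ball.measurableSet) _).symm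
          intro x hx y hy hxy
          exact disjoint_balls_of_separated ht hθ (hA x hx) (hA y hy) (hsep x hx y hy hxy)
      _ ≤ J := setLIntegral_le_lintegral _ _
  have hreal := ENNReal.toReal_mono hJ'.ne hsum
  rw [ENNReal.toReal_mul, ENNReal.toReal_mul, ENNReal.toReal_natCast,
    ENNReal.toReal_ofReal (by positivity)] at hreal
  rw [le_div_iff₀ (by positivity)]
  linarith

/-- Codebooks of cardinality `O(t ^ (-d))` whose distance function is at most
`t (1 + ‖x‖) ^ (1 + θ)`. -/
theorem exists_codebook [Nontrivial E] {θ : ℝ} (hθ : 0 < θ) :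
    ∃ C : ℝ, 0 < C ∧ ∀ t : ℝ, 0 < t → t ≤ 1 → ∃ A : Finset E, A.Nonempty ∧
      (A.card : ℝ) * t ^ Module.finrank ℝ E ≤ C ∧
      ∀ x : E, Metric.infDist x (A : Set E) ≤ t * (1 + ‖x‖) ^ (1 + θ) := by
  classical
  obtain ⟨C, hC, hcard⟩ := card_le_of_separated (E := E) Measure.addHaar hθ
  refine ⟨C + 1, by positivity, fun t ht ht1 => ?_⟩
  obtain ⟨A, ⟨hA1, hA2⟩, hmax⟩ := exists_finset_card_maximal (X := E)
    (Q := fun A => (∀ x ∈ A, t * (1 + ‖x‖) ^ θ ≤ 1) ∧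
      (∀ x ∈ A, ∀ y ∈ A, x ≠ y →
        min (t * (1 + ‖x‖) ^ (1 + θ)) (t * (1 + ‖y‖) ^ (1 + θ)) ≤ dist x y))
    (by simp) (N := C / t ^ Module.finrank ℝ E) (fun A hA => by
      rw [le_div_iff₀ (by positivity)]
      exact hcard t ht A hA.1 hA.2)
  -- The origin serves the points with `t (1 + ‖x‖) ^ θ > 1`, where the allowed distance exceeds `1
  -- + ‖x‖`; maximality of `A` serves all others. The extra point is paid for by `C + 1`, as `t ≤
  -- 1`.
  refine ⟨insert 0 A, by simp, ?_, fun x => ?_⟩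
  · have h1 := hcard t ht A hA1 hA2
    have h2 : ((insert 0 A).card : ℝ) ≤ A.card + 1 := by exact_mod_cast Finset.card_insert_le 0 A
    have h3 : t ^ Module.finrank ℝ E ≤ 1 := pow_le_one₀ ht.le ht1
    have h4 : 0 < t ^ Module.finrank ℝ E := by positivity
    nlinarith
  · by_cases hx : t * (1 + ‖x‖) ^ θ ≤ 1
    · by_cases hxA : x ∈ A
      · rw [Metric.infDist_zero_of_mem (by simp [hxA])]
        positivity
      · by_contra! hlt
        have hfar : ∀ y ∈ A, t * (1 + ‖x‖) ^ (1 + θ) ≤ dist x y := fun y hy =>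
          hlt.le.trans (Metric.infDist_le_dist_of_mem (by simp [hy]))
        have := hmax (insert x A) ⟨?_, ?_⟩
        · rw [Finset.card_insert_of_notMem hxA] at this
          omega
        · intro y hy
          rcases Finset.mem_insert.1 hy with rfl | hy
          exacts [hx, hA1 y hy]
        · intro y hy z hz hyz
          rcases Finset.mem_insert.1 hy with rfl | hyA <;>
            rcases Finset.mem_insert.1 hz with rfl | hzA
          · exact absurd rfl hyz
          · exact (min_le_left _ _).trans (hfar z hzA)
          · rw [dist_comm]
            exact (min_le_right _ _).trans (hfar y hyA)
          · exact hA2 y hyA z hzA hyz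
    · refine (Metric.infDist_le_dist_of_mem (y := (0 : E)) (by simp)).trans ?_
      rw [dist_zero_right, Real.rpow_add (by positivity), Real.rpow_one]
      nlinarith [norm_nonneg x]

end Covering

/-! ### Rate of the quantization error and number of codebook points near the unit ball. -/

section Rates

variable {E : Type*} [NormedAddCommGroup E] [NormedSpace ℝ E] [FiniteDimensional ℝ E]
  [Nontrivial E] [MeasurableSpace E] [BorelSpace E]

theorem lintegral_one_add_norm_rpow_lt_top {E : Type*} [NormedAddCommGroup E] [MeasurableSpace E]
    [BorelSpace E] {P : Measure E} [IsFiniteMeasure P]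
    {p : ℝ} (hp : 0 < p) (hint : Integrable (fun x : E => ‖x‖ ^ p) P) :
    ∫⁻ x, ENNReal.ofReal ((1 + ‖x‖) ^ p) ∂P < ⊤ := by
  have hi : Integrable (fun x : E => 2 ^ p * (1 + ‖x‖ ^ p)) P :=
    ((integrable_const 1).add hint).const_mul _
  refine lt_of_le_of_lt (lintegral_mono fun x => ENNReal.ofReal_le_ofReal ?_) hi.lintegral_lt_top
  calc (1 + ‖x‖) ^ p ≤ (2 * max 1 ‖x‖) ^ p := by
        refine Real.rpow_le_rpow (by positivity) ?_ hp.le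
        linarith [le_max_left 1 ‖x‖, le_max_right 1 ‖x‖]
    _ = 2 ^ p * max 1 ‖x‖ ^ p := Real.mul_rpow (by norm_num) (by positivity)
    _ ≤ _ := by
        gcongr
        have : 0 ≤ ‖x‖ ^ p := by positivity
        rcases max_choice 1 ‖x‖ with h | h <;> rw [h]
        · simpa using this
        · linarith

/-- The order `n ^ (-r / d)` of the quantization error under a moment condition, expressed in
`ν = n ^ (-1 / d)`. -/
theorem quantErrorPow_le_rate {P : Measure E} [IsFiniteMeasure P] {r δ : ℝ} (hr : 0 < r)
    (hδ : 0 < δ) (hint : Integrable (fun x : E => ‖x‖ ^ (r + δ)) P) :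
    ∃ C : ℝ, 0 < C ∧ ∃ n₀ : ℕ, ∀ n : ℕ, n₀ ≤ n → ∀ ν : ℝ, 0 < ν →
      ν ^ Module.finrank ℝ E * n = 1 → quantErrorPow P r n ≤ ENNReal.ofReal (C * ν ^ r) := by
  -- With `θ = δ / r`, the `r`-th power of `(1 + ‖x‖) ^ (1 + θ)` is exactly the integrable `(1 +
  -- ‖x‖) ^ (r + δ)`.
  obtain ⟨C₀, hC₀, hbook⟩ := exists_codebook (E := E) (div_pos hδ hr)
  have hd : Module.finrank ℝ E ≠ 0 := (Module.finrank_pos (R := ℝ) (M := E)).ne'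
  set d := Module.finrank ℝ E
  set J := ∫⁻ x, ENNReal.ofReal ((1 + ‖x‖) ^ (r + δ)) ∂P with hJ
  have hJ' : J < ⊤ := lintegral_one_add_norm_rpow_lt_top (by positivity) hint
  set b : ℝ := C₀ ^ ((d : ℝ)⁻¹) with hb
  have hb0 : 0 < b := by positivity
  have hbd : b ^ d = C₀ := Real.rpow_inv_natCast_pow hC₀.le hd
  refine ⟨b ^ r * (J.toReal + 1), by positivity, ⌈C₀⌉₊, fun n hn ν hν hνn => ?_⟩
  have hn' : C₀ ≤ n := Nat.ceil_le.1 hn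
  have htd : (b * ν) ^ d = C₀ * ν ^ d := by rw [mul_pow, hbd]
  have hνd : 0 < ν ^ d := by positivity
  have ht1 : b * ν ≤ 1 := by
    refine (pow_le_one_iff_of_nonneg (by positivity) hd).1 ?_
    rw [htd]; nlinarith
  obtain ⟨A, hA, hcard, hdist⟩ := hbook (b * ν) (by positivity) ht1
  have hcn : A.card ≤ n := by
    rw [htd] at hcard
    have h1 : (A.card : ℝ) * ν ^ d ≤ 1 := by
      by_contra! h
      nlinarith
    have h2 : (A.card : ℝ) ≤ n := by
      by_contra! h
      nlinarith
    exact_mod_cast h2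
  refine (quantErrorPow_le hcn).trans ?_
  calc distortion P r A
      ≤ ∫⁻ x, ENNReal.ofReal ((b * ν) ^ r) * ENNReal.ofReal ((1 + ‖x‖) ^ (r + δ)) ∂P := by
        refine lintegral_mono fun x => ?_
        rw [← ofReal_infDist_eq_infEDist (by simpa using hA),
          ENNReal.ofReal_rpow_of_nonneg Metric.infDist_nonneg hr.le,
          ← ENNReal.ofReal_mul (by positivity)]
        refine ENNReal.ofReal_le_ofReal ?_
        refine (Real.rpow_le_rpow Metric.infDist_nonneg (hdist x) hr.le).trans ?_
        rw [Real.mul_rpow (by positivity) (by positivity), ← Real.rpow_mul (by positivity)]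
        apply le_of_eq
        congr 2
        field_simp
    _ = ENNReal.ofReal ((b * ν) ^ r) * J := lintegral_const_mul _ (by fun_prop)
    _ = ENNReal.ofReal ((b * ν) ^ r) * ENNReal.ofReal J.toReal := by
        rw [ENNReal.ofReal_toReal hJ'.ne]
    _ ≤ _ := by
        rw [← ENNReal.ofReal_mul (by positivity), Real.mul_rpow hb0.le hν.le]
        refine ENNReal.ofReal_le_ofReal ?_
        have : 0 < b ^ r * ν ^ r := by positivity
        nlinarith

/-- A codebook of distortion at most `C ν ^ r` has at least a multiple of `n = ν ^ (-d)` points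
near the unit ball. -/
theorem card_filter_norm_lt_ge (lam : Measure E) [lam.IsAddHaarMeasure] {P : Measure E}
    [IsFiniteMeasure P] {r M C : ℝ} (hr : 0 < r) (hM : 0 < M) (hC : 0 < C)
    (hPM : ∀ s, MeasurableSet s → P s ≤ ENNReal.ofReal M * lam s)
    (hP0 : P (Metric.ball 0 1) ≠ 0) :
    ∃ κ : ℝ, 0 < κ ∧ ∃ n₀ : ℕ, ∀ n : ℕ, n₀ ≤ n → ∀ ν : ℝ, 0 < ν →
      ν ^ Module.finrank ℝ E * n = 1 → ∀ α : Finset E,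
      distortion P r α ≤ ENNReal.ofReal (C * ν ^ r) →
      κ * n ≤ (α.filter (fun a => ‖a‖ < 2)).card := by
  set d := Module.finrank ℝ E
  set p := (P (Metric.ball 0 1)).toReal with hp
  have hp0 : 0 < p := ENNReal.toReal_pos hP0 (measure_ne_top _ _)
  set v := (lam (Metric.ball (0 : E) 1)).toReal with hv
  have hv0 : 0 < v := measure_unit_ball_toReal_pos lam
  -- Chosen so that mass `p / 2` at distance at least `A ν` from the codebook costs `(C + 1) ν ^ r`,
  -- more than is allowed.
  set A : ℝ := (2 * (C + 1) / p) ^ r⁻¹ with hA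
  have hA0 : 0 < A := by positivity
  have hAr : A ^ r = 2 * (C + 1) / p := Real.rpow_inv_rpow (by positivity) hr.ne'
  have hd : d ≠ 0 := (Module.finrank_pos (R := ℝ) (M := E)).ne'
  refine ⟨p / (2 * M * v * A ^ d), by positivity, ⌈A ^ d⌉₊, fun n hn ν hν hνn α hα => ?_⟩
  have hn' : A ^ d ≤ n := Nat.ceil_le.1 hn
  have hνd : 0 < ν ^ d := by positivity
  have hn0 : (0 : ℝ) < n := lt_of_lt_of_le (by positivity) hn'
  set s : ℝ := A * ν with hs
  have hs0 : 0 < s := by positivity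
  have hsd : s ^ d = A ^ d * ν ^ d := mul_pow _ _ _
  have hs1 : s ≤ 1 := by
    refine (pow_le_one_iff_of_nonneg hs0.le hd).1 ?_
    rw [hsd]; nlinarith
  -- With too few points, their balls of radius `s` cover mass at most `p / 2`, leaving mass `p / 2`
  -- of the unit ball uncovered. Since `s ≤ 1`, codebook points of norm at least 2 do not come
  -- within `s` of the unit ball.
  by_contra! hlt
  set S := α.filter (fun a => ‖a‖ < 2) with hS
  set G : Set E := ⋃ a ∈ S, Metric.ball a s with hG
  have hGm : MeasurableSet G := by
    refine Finset.measurableSet_biUnion _ fun a _ => Metric.isOpen_ball.measurableSet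
  have hPG : P G ≤ ENNReal.ofReal (p / 2) := by
    calc P G ≤ ∑ a ∈ S, P (Metric.ball a s) := measure_biUnion_finset_le _ _
      _ ≤ ∑ a ∈ S, ENNReal.ofReal (M * (s ^ d * v)) := by
          refine Finset.sum_le_sum fun a _ => (hPM _ Metric.isOpen_ball.measurableSet).trans ?_
          rw [Measure.addHaar_ball lam a hs0.le, ENNReal.ofReal_mul hM.le,
            ENNReal.ofReal_mul (by positivity), hv, ENNReal.ofReal_toReal measure_ball_lt_top.ne]
      _ = ENNReal.ofReal (S.card * (M * (s ^ d * v))) := by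
          rw [Finset.sum_const, nsmul_eq_mul, ENNReal.ofReal_mul (Nat.cast_nonneg S.card),
            ENNReal.ofReal_natCast]
      _ ≤ _ := by
          refine ENNReal.ofReal_le_ofReal ?_
          calc (S.card : ℝ) * (M * (s ^ d * v))
              ≤ (p / (2 * M * v * A ^ d) * n) * (M * (s ^ d * v)) := by gcongr
            _ = p / 2 * (ν ^ d * n) := by rw [hsd]; field_simp
            _ = p / 2 := by rw [hνn, mul_one]
  have hdiff : ENNReal.ofReal (p / 2) ≤ P (Metric.ball 0 1 \ G) := by
    have h1 : P (Metric.ball 0 1) ≤ P G + P (Metric.ball 0 1 \ G) := by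
      rw [add_comm]; exact tsub_le_iff_right.1 (le_measure_sdiff)
    have h2 : P (Metric.ball 0 1) = ENNReal.ofReal (p / 2) + ENNReal.ofReal (p / 2) := by
      rw [← ENNReal.ofReal_add (by positivity) (by positivity), add_halves, hp,
        ENNReal.ofReal_toReal (measure_ne_top _ _)]
    rw [h2] at h1
    exact (ENNReal.add_le_add_iff_left ENNReal.ofReal_ne_top).1
      (h1.trans (add_le_add_left hPG _))
  have hlow : ENNReal.ofReal (s ^ r * (p / 2)) ≤ distortion P r α := by
    calc ENNReal.ofReal (s ^ r * (p / 2))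
        ≤ ENNReal.ofReal s ^ r * P (Metric.ball 0 1 \ G) := by
          rw [ENNReal.ofReal_mul (by positivity), ENNReal.ofReal_rpow_of_nonneg hs0.le hr.le]
          gcongr
      _ = ∫⁻ x in Metric.ball 0 1 \ G, ENNReal.ofReal s ^ r ∂P := (setLIntegral_const _ _).symm
      _ ≤ ∫⁻ x in Metric.ball 0 1 \ G, Metric.infEDist x (α : Set E) ^ r ∂P := by
          refine setLIntegral_mono' (Metric.isOpen_ball.measurableSet.diff hGm) fun x hx => ?_
          refine ENNReal.rpow_le_rpow (Metric.le_infEDist.2 fun a ha => ?_) hr.le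
          rw [edist_dist]
          refine ENNReal.ofReal_le_ofReal ?_
          by_contra! hxa
          refine hx.2 (Set.mem_biUnion (x := a) ?_ hxa)
          have h0 : ‖x‖ < 1 := by simpa using hx.1
          refine Finset.mem_coe.2 (Finset.mem_filter.2 ⟨ha, ?_⟩)
          have : ‖a‖ ≤ ‖x‖ + dist x a := by
            rw [dist_comm, dist_eq_norm]; simpa using norm_add_le x (a - x)
          linarith
      _ ≤ _ := setLIntegral_le_lintegral _ _
  have := (ENNReal.ofReal_le_ofReal_iff (by positivity)).1 (hlow.trans hα)
  rw [hs, Real.mul_rpow hA0.le hν.le, hAr] at this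
  have hνr : 0 < ν ^ r := by positivity
  have h3 : 2 * (C + 1) / p * ν ^ r * (p / 2) = (C + 1) * ν ^ r := by field_simp
  rw [h3] at this
  linarith

/-- Disjoint balls of radius `u / 2` fit into the ball of radius 3. This bounds the number of
isolated codebook points. -/
theorem card_mul_pow_le_of_separated_of_norm_lt {u : ℝ} (hu : 0 < u) (hu2 : u ≤ 2)
    {T : Finset E} (hT : ∀ a ∈ T, ‖a‖ < 2)
    (hsep : ∀ a ∈ T, ∀ b ∈ T, a ≠ b → u ≤ dist a b) :
    (T.card : ℝ) * u ^ Module.finrank ℝ E ≤ 6 ^ Module.finrank ℝ E := by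
  set lam : Measure E := Measure.addHaar
  set d := Module.finrank ℝ E with hd
  set v := lam (Metric.ball (0 : E) 1) with hv
  have hv0 : 0 < v.toReal := measure_unit_ball_toReal_pos lam
  have h1 : (T.card : ENNReal) * (ENNReal.ofReal ((u / 2) ^ d) * v) ≤
      ENNReal.ofReal (3 ^ d) * v := by
    calc (T.card : ENNReal) * (ENNReal.ofReal ((u / 2) ^ d) * v)
        = ∑ a ∈ T, lam (Metric.ball a (u / 2)) := by
          simp [Measure.addHaar_ball lam _ (by positivity : 0 ≤ u / 2), hv, hd]
      _ = lam (⋃ a ∈ T, Metric.ball a (u / 2)) := by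
          refine (measure_biUnion_finset ?_ fun a _ => Metric.isOpen_ball.measurableSet).symm
          intro a ha b hb hab
          exact Metric.ball_disjoint_ball (by linarith [hsep a ha b hb hab])
      _ ≤ lam (Metric.ball 0 3) := by
          refine measure_mono (Set.iUnion₂_subset fun a ha => ?_)
          refine Metric.ball_subset_ball' ?_
          rw [dist_zero_right]
          linarith [hT a ha]
      _ = _ := Measure.addHaar_ball lam 0 (by norm_num)
  have h2 := ENNReal.toReal_mono (ENNReal.mul_ne_top ENNReal.ofReal_ne_top
    measure_ball_lt_top.ne) h1
  rw [ENNReal.toReal_mul, ENNReal.toReal_mul, ENNReal.toReal_mul, ENNReal.toReal_natCast,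
    ENNReal.toReal_ofReal (by positivity), ENNReal.toReal_ofReal (by positivity), ← mul_assoc] at h2
  have h3 := le_of_mul_le_mul_right h2 hv0
  rw [div_pow, show (6 : ℝ) = 3 * 2 by norm_num, mul_pow] at *
  have h4 : (0 : ℝ) < 2 ^ d := by positivity
  calc (T.card : ℝ) * u ^ d = T.card * (u ^ d / 2 ^ d) * 2 ^ d := by field_simp
    _ ≤ _ := by gcongr

end Rates

/-! ### Upper bound for the increments of the quantization error. -/

section Increments

/-- These are the open Voronoi cells. Disjointness lets the removal costs be summed into a single
integral. -/
theorem pairwiseDisjoint_edist_lt_infEDist_erase {E : Type*} [PseudoEMetricSpace E] [DecidableEq E]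
    (α : Finset E) (S : Finset E) (hS : S ⊆ α) :
    (S : Set E).PairwiseDisjoint
      fun a => {x | edist x a < Metric.infEDist x (α.erase a : Set E)} := by
  intro a ha b hb hab
  refine Set.disjoint_left.2 fun x (hxa : edist x a < _) (hxb : edist x b < _) => ?_
  have h1 : edist x a < edist x b := hxa.trans_le
    (Metric.infEDist_le_edist_of_mem (by simp [hab.symm, hS hb]))
  have h2 : edist x b < edist x a := hxb.trans_le
    (Metric.infEDist_le_edist_of_mem (by simp [hab, hS ha]))
  exact lt_asymm h1 h2

variable {E : Type*} [NormedAddCommGroup E] [NormedSpace ℝ E] [FiniteDimensional ℝ E]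
  [Nontrivial E] [MeasurableSpace E] [BorelSpace E]

/-- Some point can be removed from a codebook of distortion at most `C ν ^ r` at the cost
`O(ν ^ (r + d))`. -/
theorem exists_distortion_erase_le [DecidableEq E] (lam : Measure E) [lam.IsAddHaarMeasure]
    {P : Measure E} [IsProbabilityMeasure P] {r M C : ℝ} (hr : 0 < r) (hM : 0 < M) (hC : 0 < C)
    (hPM : ∀ s, MeasurableSet s → P s ≤ ENNReal.ofReal M * lam s)
    (hP0 : P (Metric.ball 0 1) ≠ 0) :
    ∃ C' : ℝ, 0 < C' ∧ ∃ n₀ : ℕ, ∀ n : ℕ, n₀ ≤ n → ∀ ν : ℝ, 0 < ν →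
      ν ^ Module.finrank ℝ E * n = 1 → ∀ α : Finset E,
      distortion P r α ≤ ENNReal.ofReal (C * ν ^ r) →
      ∃ a ∈ α, distortion P r (α.erase a) ≤ distortion P r α +
        ENNReal.ofReal (C' * ν ^ (r + Module.finrank ℝ E)) := by
  obtain ⟨κ, hκ, n₁, hcount⟩ := card_filter_norm_lt_ge lam hr hM hC hPM hP0
  have hd : Module.finrank ℝ E ≠ 0 := (Module.finrank_pos (R := ℝ) (M := E)).ne'
  set d := Module.finrank ℝ E
  -- Makes `6 ^ d / u ^ d` equal to `κ n / 2` for `u = 6 b ν`, so at most half of the guaranteed `κ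
  -- n` points are isolated at scale `u`.
  set b : ℝ := (2 / κ) ^ ((d : ℝ)⁻¹) with hb
  have hb0 : 0 < b := by positivity
  have hbd : b ^ d = 2 / κ := Real.rpow_inv_natCast_pow (by positivity) hd
  set U : ℝ := 6 * b with hU
  have hU0 : 0 < U := by positivity
  refine ⟨2 ^ r * ((C + U ^ r) * (2 / κ)), by positivity, max n₁ ⌈U ^ d⌉₊,
    fun n hn ν hν hνn α hα => ?_⟩
  have hn1 := hcount n ((le_max_left _ _).trans hn) ν hν hνn α hα
  have hn2 : U ^ d ≤ n := Nat.ceil_le.1 ((le_max_right _ _).trans hn)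
  have hn0 : (0 : ℝ) < n := lt_of_lt_of_le (by positivity) hn2
  have hνd : 0 < ν ^ d := by positivity
  set u : ℝ := U * ν with hu
  have hu0 : 0 < u := by positivity
  have hud : u ^ d = U ^ d * ν ^ d := mul_pow _ _ _
  have hu1 : u ≤ 1 := by
    refine (pow_le_one_iff_of_nonneg hu0.le hd).1 ?_
    rw [hud]; nlinarith
  set S := α.filter (fun a => ‖a‖ < 2) with hS
  set T := S.filter (fun a => ENNReal.ofReal u ≤ Metric.infEDist a (α.erase a : Set E)) with hT
  set S' := S.filter (fun a => ¬ ENNReal.ofReal u ≤ Metric.infEDist a (α.erase a : Set E)) with hS'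
  have hTcard : (T.card : ℝ) ≤ κ * n / 2 := by
    have h1 : (T.card : ℝ) * u ^ d ≤ 6 ^ d := by
      refine card_mul_pow_le_of_separated_of_norm_lt hu0 (by linarith) ?_ ?_
      · intro a ha
        exact (Finset.mem_filter.1 (Finset.mem_filter.1 ha).1).2
      · intro a ha c hc hac
        have hcα : c ∈ α := (Finset.mem_filter.1 (Finset.mem_filter.1 hc).1).1
        have h2 := (Finset.mem_filter.1 ha).2.trans
          (Metric.infEDist_le_edist_of_mem (y := c) (by simp [hac.symm, hcα]))
        rw [edist_dist] at h2
        exact (ENNReal.ofReal_le_ofReal_iff dist_nonneg).1 h2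
    have h3 : (T.card : ℝ) * (2 / κ * ν ^ d) ≤ 1 := by
      rw [hud, hU, mul_pow, hbd] at h1
      have h6 : (0 : ℝ) < 6 ^ d := by positivity
      refine le_of_mul_le_mul_right ?_ h6
      linarith
    have h4 : (T.card : ℝ) * (2 / κ * ν ^ d) * (κ * n / 2) = T.card * (ν ^ d * n) := by
      field_simp
    rw [hνn, mul_one] at h4
    rw [← h4]
    have : 0 ≤ κ * n / 2 := by positivity
    nlinarith
  have hScard : κ * n / 2 ≤ S'.card := by
    have h1 : T.card + S'.card = S.card := Finset.card_filter_add_card_filter_not _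
    have h2 : (T.card : ℝ) + S'.card = S.card := by exact_mod_cast h1
    linarith
  have hS'0 : S'.Nonempty := by
    rw [← Finset.card_pos]
    have : (0 : ℝ) < S'.card := lt_of_lt_of_le (by positivity) hScard
    exact_mod_cast this
  have hS'α : S' ⊆ α := (Finset.filter_subset _ _).trans (Finset.filter_subset _ _)
  set V : E → Set E := fun a => {x | edist x a < Metric.infEDist x (α.erase a : Set E)} with hV
  set F : E → ENNReal := fun a => ∫⁻ x in V a,
    (Metric.infEDist x (α : Set E) ^ r + ENNReal.ofReal u ^ r) ∂P with hF
  have hsum : ∑ a ∈ S', F a ≤ ENNReal.ofReal ((C + U ^ r) * ν ^ r) := by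
    calc ∑ a ∈ S', F a = ∫⁻ x in ⋃ a ∈ S', V a,
          (Metric.infEDist x (α : Set E) ^ r + ENNReal.ofReal u ^ r) ∂P := by
          refine (lintegral_biUnion_finset
            (pairwiseDisjoint_edist_lt_infEDist_erase α S' hS'α) (fun a _ => ?_) _).symm
          exact (isOpen_lt (by fun_prop) Metric.continuous_infEDist).measurableSet
      _ ≤ ∫⁻ x, (Metric.infEDist x (α : Set E) ^ r + ENNReal.ofReal u ^ r) ∂P :=
          setLIntegral_le_lintegral _ _
      _ = distortion P r α + ENNReal.ofReal u ^ r := by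
          rw [lintegral_add_right _ measurable_const, lintegral_const, measure_univ, mul_one]
          rfl
      _ ≤ ENNReal.ofReal (C * ν ^ r) + ENNReal.ofReal (U ^ r * ν ^ r) := by
          rw [ENNReal.ofReal_rpow_of_nonneg hu0.le hr.le, hu, Real.mul_rpow hU0.le hν.le]
          gcongr
      _ = _ := by
          rw [← ENNReal.ofReal_add (by positivity) (by positivity), add_mul]
  -- The cheapest of at least `κ n / 2` cells costs no more than the average, which gains the factor
  -- `2 / (κ n) = (2 / κ) ν ^ d`.
  obtain ⟨a, ha, hmin⟩ := Finset.exists_min_image S' F hS'0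
  have hFa : F a ≤ ENNReal.ofReal ((C + U ^ r) * (2 / κ) * ν ^ (r + d)) := by
    have h1 : F a * ENNReal.ofReal (κ * n / 2) ≤ ENNReal.ofReal ((C + U ^ r) * ν ^ r) := by
      calc F a * ENNReal.ofReal (κ * n / 2) ≤ F a * S'.card := by
            gcongr
            rw [← ENNReal.ofReal_natCast]
            exact ENNReal.ofReal_le_ofReal hScard
        _ = ∑ _x ∈ S', F a := by rw [Finset.sum_const, nsmul_eq_mul, mul_comm]
        _ ≤ ∑ x ∈ S', F x := Finset.sum_le_sum hmin
        _ ≤ _ := hsum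
    have hq : 0 < κ * n / 2 := by positivity
    refine (ENNReal.le_div_iff_mul_le (Or.inl (by simpa using hq)) (Or.inl (by simp))).2 h1
      |>.trans ?_
    rw [← ENNReal.ofReal_div_of_pos hq]
    refine ENNReal.ofReal_le_ofReal (le_of_eq ?_)
    rw [Real.rpow_add hν, Real.rpow_natCast, div_eq_iff hq.ne']
    have : (C + U ^ r) * (2 / κ) * (ν ^ r * ν ^ d) * (κ * n / 2) =
      (C + U ^ r) * ν ^ r * (ν ^ d * n) := by field_simp
    rw [this, hνn, mul_one]
  have hu' := (not_le.1 (Finset.mem_filter.1 ha).2).le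
  refine ⟨a, hS'α ha, (distortion_erase_le P hr (hS'α ha) hu').trans ?_⟩
  refine add_le_add le_rfl ((mul_le_mul' le_rfl hFa).trans ?_)
  rw [← ENNReal.ofReal_mul (by positivity), ← mul_assoc (2 ^ r)]

/-- The increments of the quantization errors are `O(ν ^ (r + d))`. -/
theorem quantErrorPow_le_succ_add (lam : Measure E) [lam.IsAddHaarMeasure]
    {P : Measure E} [IsProbabilityMeasure P] {r δ M : ℝ} (hr : 0 < r) (hM : 0 < M)
    (hδ : 0 < δ) (hint : Integrable (fun x : E => ‖x‖ ^ (r + δ)) P)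
    (hPM : ∀ s, MeasurableSet s → P s ≤ ENNReal.ofReal M * lam s)
    (hP0 : P (Metric.ball 0 1) ≠ 0) {α : ℕ → Finset E}
    (hα : ∀ n : ℕ, 1 ≤ n → IsOptimalCodebook P r n (α n)) :
    ∃ C : ℝ, 0 < C ∧ ∃ n₀ : ℕ, ∀ n : ℕ, n₀ ≤ n → ∀ ν : ℝ, 0 < ν →
      ν ^ Module.finrank ℝ E * n = 1 → quantErrorPow P r (n + 1) < ⊤ ∧
      quantErrorPow P r n ≤ quantErrorPow P r (n + 1) +
        ENNReal.ofReal (C * ν ^ (r + Module.finrank ℝ E)) := by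
  classical
  obtain ⟨C, hC, n₁, h1⟩ := quantErrorPow_le_rate hr hδ hint
  obtain ⟨C', hC', n₂, h2⟩ := exists_distortion_erase_le lam hr hM hC hPM hP0
  have hd : Module.finrank ℝ E ≠ 0 := (Module.finrank_pos (R := ℝ) (M := E)).ne'
  set d := Module.finrank ℝ E
  refine ⟨C', hC', max n₁ n₂, fun n hn ν hν hνn => ?_⟩
  -- The analogue of `ν` for `n + 1`: the point is removed from `α (n + 1)`, and `μ ≤ ν` transfers
  -- the bound.
  set μ : ℝ := ((n + 1 : ℕ) : ℝ)⁻¹ ^ ((d : ℝ)⁻¹) with hμ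
  have hμ0 : 0 < μ := by positivity
  have hμd : μ ^ d = ((n + 1 : ℕ) : ℝ)⁻¹ := Real.rpow_inv_natCast_pow (by positivity) hd
  have hμn : μ ^ d * ((n + 1 : ℕ) : ℝ) = 1 := by
    rw [hμd]; exact inv_mul_cancel₀ (by positivity)
  have hμν : μ ≤ ν := by
    refine (pow_le_pow_iff_left₀ hμ0.le hν.le hd).1 ?_
    have hνd : 0 < ν ^ d := by positivity
    have hμd0 : 0 < μ ^ d := by positivity
    push_cast at hμn
    have : (0 : ℝ) ≤ n := Nat.cast_nonneg n
    by_contra! hlt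
    nlinarith
  have hrate := h1 (n + 1) (by omega) μ hμ0 hμn
  refine ⟨hrate.trans_lt ENNReal.ofReal_lt_top, ?_⟩
  have hopt := hα (n + 1) (by omega)
  obtain ⟨a, ha, hle⟩ := h2 (n + 1) (by omega) μ hμ0 hμn (α (n + 1)) (hopt.2 ▸ hrate)
  rw [hopt.2] at hle
  refine (quantErrorPow_le ?_).trans (hle.trans ?_)
  · rw [Finset.card_erase_of_mem ha]
    have := hopt.1
    omega
  · gcongr

end Increments

/-! ### Consequences of the peakless sublevel tail property. -/

section Tail

variable {E : Type*} [NormedAddCommGroup E] [MeasurableSpace E]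

/-- Under the peakless sublevel tail property, the essential bound of the density holds everywhere
outside the closed ball of radius `R`. -/
theorem PeaklessSublevelTail.le_of_notMem_closedBall {lam P : Measure E} [lam.IsAddHaarMeasure]
    {h : E → ℝ} {R : ℝ} (hP : PeaklessSublevelTail lam P h R) {M : ℝ}
    (hM : ∀ᵐ x ∂lam, h x ≤ M) {x : E} (hx : x ∉ Metric.closedBall (0 : E) R) : h x ≤ M := by
  obtain ⟨I, f, g, -, hfI, ⟨hf, s₀, hs₀, cf, hcf, hpeak⟩, hg, -, hgf⟩ := hP.tail
  have hxR : R < ‖x‖ := by simpa using hx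
  -- The second bound keeps the ball outside radius `R`, where `f y ≤ f x` implies `h x ≤ h y`.
  set s := min (s₀ / 2) (‖x‖ - R) with hs
  have hs0 : 0 < s := lt_min (by positivity) (by linarith)
  have hpos : 0 < lam ({y | f y ≤ f x} ∩ Metric.ball x s) := by
    refine lt_of_lt_of_le ?_ (hpeak x hx s hs0 ((min_le_left _ _).trans_lt (by linarith)))
    exact ENNReal.mul_pos (by simpa using hcf) (Metric.measure_ball_pos lam x hs0).ne'
  obtain ⟨y, ⟨hyf, hyb⟩, hyM⟩ : ∃ y ∈ {y | f y ≤ f x} ∩ Metric.ball x s, h y ≤ M := by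
    by_contra! hno
    exact hpos.ne' (measure_mono_null (fun y hy => by simpa using hno y hy) hM)
  have hyR : R ≤ ‖y‖ := by
    have h1 : dist y x < ‖x‖ - R := (Metric.mem_ball.1 hyb).trans_le (min_le_right _ _)
    have h2 : ‖x‖ ≤ ‖y‖ + dist y x := by
      rw [dist_comm, dist_eq_norm]; simpa using norm_add_le y (x - y)
    linarith
  rw [hgf x hxR.le]
  refine le_trans ?_ hyM
  rw [hgf y hyR]
  exact hg (hfI y) (hfI x) hyf

theorem ofReal_mul_le_withDensity {X : Type*} [MeasurableSpace X] {lam : Measure X} {h : X → ℝ} {c : ℝ} {A : Set X}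
    (hA : MeasurableSet A) (hc : ∀ y ∈ A, c ≤ h y) :
    ENNReal.ofReal c * lam A ≤ lam.withDensity (fun x => ENNReal.ofReal (h x)) A := by
  rw [withDensity_apply _ hA, ← setLIntegral_const]
  exact setLIntegral_mono' hA fun y hy => ENNReal.ofReal_le_ofReal (hc y hy)

variable [NormedSpace ℝ E] [FiniteDimensional ℝ E] [Nontrivial E] [BorelSpace E]

/-- Small balls have at least a multiple of the mass that the density at their centre suggests. -/
theorem PeaklessSublevelTail.le_measure_ball {lam P : Measure E} [lam.IsAddHaarMeasure]
    {h : E → ℝ} {R : ℝ} (hR : 0 < R) (hP : PeaklessSublevelTail lam P h R) {M : ℝ} (hM : 0 < M) :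
    ∃ c : ℝ, 0 < c ∧ ∃ s₀ : ℝ, 0 < s₀ ∧ ∀ x : E, h x ≤ M → ∀ s : ℝ, 0 < s → s < s₀ →
      ENNReal.ofReal (c * h x * s ^ Module.finrank ℝ E) ≤ P (Metric.ball x s) := by
  obtain ⟨I, f, g, -, hfI, ⟨hf, s₀, hs₀, cf, hcf, hpeak⟩, hg, hgpos, hgf⟩ := hP.tail
  obtain ⟨c₁, hc₁, hlow⟩ := hP.bounded_below (R + s₀) (by positivity)
  set v := (lam (Metric.ball (0 : E) 1)).toReal with hv
  have hv0 : 0 < v := measure_unit_ball_toReal_pos lam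
  -- Then `q * h x` is below both `h x` and `c₁`: the first bounds `h` on the tail part of the
  -- sublevel set, the second at all points of norm at most `R + s₀`.
  set q : ℝ := min 1 (c₁ / M) with hq
  have hq0 : 0 < q := lt_min one_pos (by positivity)
  have hball : ∀ (x : E) (s : ℝ), 0 < s → lam (Metric.ball x s) =
      ENNReal.ofReal (s ^ Module.finrank ℝ E * v) := fun x s hs => by
    rw [Measure.addHaar_ball lam x hs.le, ENNReal.ofReal_mul (by positivity), hv,
      ENNReal.ofReal_toReal measure_ball_lt_top.ne]
  have hpos : ∀ x, 0 < h x := fun x => by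
    obtain ⟨c, hc, hcx⟩ := hP.bounded_below (‖x‖ + 1) (by positivity)
    exact hc.trans_le (hcx x (by simp))
  have hqh : ∀ x, h x ≤ M → q * h x ≤ h x ∧ q * h x ≤ c₁ := fun x hx => by
    constructor
    · have := mul_le_mul_of_nonneg_right (min_le_left 1 (c₁ / M)) (hpos x).le
      linarith
    · calc q * h x ≤ c₁ / M * M := by
            have := hpos x
            gcongr
            exact min_le_right _ _
        _ = c₁ := by field_simp
  set e : ℝ := min cf 1 with he
  have he0 : 0 < e := lt_min hcf one_pos
  refine ⟨q * (e * v), by positivity, s₀, hs₀, fun x hxM s hs hss => ?_⟩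
  obtain ⟨hqh1, hqh2⟩ := hqh x hxM
  have hx0 := hpos x
  have hsplit : ENNReal.ofReal (q * (e * v) * h x * s ^ Module.finrank ℝ E) =
      ENNReal.ofReal (q * h x) * (ENNReal.ofReal e * lam (Metric.ball x s)) := by
    rw [hball x s hs, ← ENNReal.ofReal_mul he0.le, ← ENNReal.ofReal_mul (by positivity)]
    congr 1
    ring
  rw [hsplit]
  by_cases hx : x ∈ Metric.closedBall (0 : E) R
  · calc ENNReal.ofReal (q * h x) * (ENNReal.ofReal e * lam (Metric.ball x s))
        ≤ ENNReal.ofReal (q * h x) * (1 * lam (Metric.ball x s)) := by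
          gcongr
          exact ENNReal.ofReal_le_one.2 (min_le_right _ _)
      _ ≤ P (Metric.ball x s) := by
          rw [one_mul, hP.density]
          refine ofReal_mul_le_withDensity Metric.isOpen_ball.measurableSet fun y hy => ?_
          refine hqh2.trans (hlow y ?_)
          have h1 : dist y x < s := hy
          have h2 : ‖x‖ ≤ R := by simpa using hx
          have h3 : ‖y‖ ≤ ‖x‖ + dist y x := by
            rw [dist_eq_norm]; simpa using norm_add_le x (y - x)
          simp only [mem_closedBall_zero_iff]
          linarith
  · have hxR : R < ‖x‖ := by simpa using hx
    calc ENNReal.ofReal (q * h x) * (ENNReal.ofReal e * lam (Metric.ball x s))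
        ≤ ENNReal.ofReal (q * h x) * (ENNReal.ofReal cf * lam (Metric.ball x s)) := by
          gcongr
          exact min_le_left _ _
      _ ≤ ENNReal.ofReal (q * h x) * lam ({y | f y ≤ f x} ∩ Metric.ball x s) := by
          gcongr
          exact hpeak x hx s hs hss
      _ ≤ P ({y | f y ≤ f x} ∩ Metric.ball x s) := by
          rw [hP.density]
          refine ofReal_mul_le_withDensity
            ((measurableSet_le hf measurable_const).inter Metric.isOpen_ball.measurableSet) ?_
          intro y hy
          by_cases hyR : R ≤ ‖y‖
          · refine hqh1.trans ?_
            rw [hgf x hxR.le, hgf y hyR]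
            exact hg (hfI y) (hfI x) hy.1
          · refine hqh2.trans (hlow y ?_)
            simp only [mem_closedBall_zero_iff]
            linarith
      _ ≤ _ := measure_mono Set.inter_subset_right

end Tail

/-! ### Comparison of the two increment bounds, and the theorem. -/

/-- The upper bound for `d(x, α_n)` at the points where the density is at most `M`. -/
theorem PeaklessSublevelTail.infDist_le {E : Type*} [NormedAddCommGroup E] [NormedSpace ℝ E]
    [FiniteDimensional ℝ E] [Nontrivial E] [MeasurableSpace E] [BorelSpace E]
    {lam : Measure E} [lam.IsAddHaarMeasure] {P : Measure E} [IsProbabilityMeasure P] {h : E → ℝ}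
    {r δ : ℝ} (hr : 0 < r) (hδ : 0 < δ) (hint : Integrable (fun x : E => ‖x‖ ^ (r + δ)) P)
    {α : ℕ → Finset E} (hα : ∀ n : ℕ, 1 ≤ n → IsOptimalCodebook P r n (α n))
    {R : ℝ} (hR : 0 < R) (hP : PeaklessSublevelTail lam P h R) {M : ℝ} (hM : 0 < M)
    (hhM : ∀ᵐ x ∂lam, h x ≤ M) :
    ∃ c : ℝ, 0 < c ∧ ∀ K : Set E, IsCompact K → ∃ nK : ℕ, ∀ n : ℕ, nK ≤ n →
      ∀ x ∈ K, h x ≤ M → Metric.infDist x (α n : Set E) ≤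
        c * (n : ℝ) ^ (-(1 / (Module.finrank ℝ E : ℝ))) *
          h x ^ (-(1 / (r + (Module.finrank ℝ E : ℝ)))) := by
  classical
  have hPM : ∀ s, MeasurableSet s → P s ≤ ENNReal.ofReal M * lam s := fun s hs => by
    rw [hP.density, withDensity_apply _ hs, ← setLIntegral_const]
    exact setLIntegral_mono_ae' hs (hhM.mono fun x hx _ => ENNReal.ofReal_le_ofReal hx)
  have hP0 : P (Metric.ball 0 1) ≠ 0 := by
    obtain ⟨c, hc, hcx⟩ := hP.bounded_below 1 one_pos
    have h1 : ENNReal.ofReal c * lam (Metric.ball 0 1) ≤ P (Metric.ball 0 1) := by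
      rw [hP.density]
      exact ofReal_mul_le_withDensity Metric.isOpen_ball.measurableSet
        fun y hy => hcx y (Metric.ball_subset_closedBall hy)
    refine (lt_of_lt_of_le ?_ h1).ne'
    exact ENNReal.mul_pos (by simpa using hc) (Metric.measure_ball_pos lam 0 one_pos).ne'
  obtain ⟨C, hC, n₁, hincr⟩ := quantErrorPow_le_succ_add lam hr hM hδ hint hPM hP0 hα
  obtain ⟨c, hc, s₀, hs₀, hlocal⟩ := hP.le_measure_ball hR hM
  have hd : Module.finrank ℝ E ≠ 0 := (Module.finrank_pos (R := ℝ) (M := E)).ne'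
  set d := Module.finrank ℝ E
  set q : ℝ := (3 / 4 : ℝ) ^ r - (1 / 4 : ℝ) ^ r with hq
  have hq0 : 0 < q := sub_pos.2 (Real.rpow_lt_rpow (by norm_num) (by norm_num) hr)
  -- the micro-macro inequality
  have hmicro : ∀ n : ℕ, max n₁ 1 ≤ n → ∀ ν : ℝ, 0 < ν → ν ^ d * n = 1 → ∀ x : E, h x ≤ M →
      ∀ s : ℝ, 0 < s → s < s₀ → s ≤ Metric.infDist x (α n : Set E) / 4 →
      q * Metric.infDist x (α n : Set E) ^ r * (c * h x * s ^ d) ≤ C * ν ^ (r + d) := by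
    intro n hn ν hν hνn x hxM s hs hss hsD
    obtain ⟨hfin, hinc⟩ := hincr n ((le_max_left _ _).trans hn) ν hν hνn
    have hopt := hα n ((le_max_right _ _).trans hn)
    -- `infDist` to the empty set is 0 by default, which contradicts `0 < s ≤ infDist / 4`.
    have hne : (α n).Nonempty := by
      by_contra hempty
      rw [Finset.not_nonempty_iff_eq_empty.1 hempty] at hsD
      simp at hsD
      linarith
    have h1 := distortion_insert_add_le P hr (y := x) hne hsD
    have h2 : quantErrorPow P r (n + 1) ≤ distortion P r (insert x (α n)) :=
      quantErrorPow_le ((Finset.card_insert_le _ _).trans (by have := hopt.1; omega))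
    rw [hopt.2] at h1
    have h3 := ((add_le_add h2 le_rfl).trans h1).trans hinc
    have h4 := (ENNReal.add_le_add_iff_left hfin.ne).1 h3
    have h5 := (mul_le_mul' le_rfl (hlocal x hxM s hs hss)).trans h4
    have hD : 0 ≤ Metric.infDist x (α n : Set E) := Metric.infDist_nonneg
    rw [← ENNReal.ofReal_mul (by positivity)] at h5
    exact (ENNReal.ofReal_le_ofReal_iff (by positivity)).1 h5
  set p : ℝ := r + d with hp
  have hp0 : 0 < p := by positivity
  set B : ℝ := C * 4 ^ d / (q * c) with hB
  have hB0 : 0 < B := by positivity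
  refine ⟨B ^ p⁻¹, by positivity, fun K hK => ?_⟩
  obtain ⟨ρ, hρ⟩ := hK.isBounded.subset_closedBall (0 : E)
  obtain ⟨cK, hcK, hK'⟩ := hP.bounded_below (max ρ 1) (by positivity)
  set s := s₀ / 2 with hs
  have hs0 : 0 < s := by positivity
  -- If `D / 4 ≥ s₀`, the increment would be at least `η`, yet it is at most `C ν ^ d = C / n`; so
  -- `n > C / η` forces `D / 4 < s₀` on `K`. Thus `K` affects the threshold for `n` but not the
  -- constant.
  set η : ℝ := q * (4 * s) ^ r * (c * cK * s ^ d) with hη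
  have hη0 : 0 < η := by positivity
  obtain ⟨n₂, hn₂⟩ := exists_nat_gt (C / η)
  refine ⟨max (max n₁ 1) n₂, fun n hn x hxK hxM => ?_⟩
  have hn1 : max n₁ 1 ≤ n := (le_max_left _ _).trans hn
  have hnpos : 1 ≤ n := (le_max_right _ _).trans hn1
  have hn0 : (0 : ℝ) < n := by exact_mod_cast hnpos
  have hn2 : C / η < n := hn₂.trans_le (by exact_mod_cast (le_max_right _ _).trans hn)
  set ν : ℝ := (n : ℝ) ^ (-(1 / (d : ℝ))) with hν
  have hν0 : 0 < ν := by positivity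
  have hνd : ν ^ d * n = 1 := by
    rw [hν, ← Real.rpow_natCast, ← Real.rpow_mul hn0.le]
    have : -(1 / (d : ℝ)) * d = -1 := by
      have : (d : ℝ) ≠ 0 := by exact_mod_cast hd
      field_simp
    rw [this, Real.rpow_neg_one]
    exact inv_mul_cancel₀ hn0.ne'
  have hν1 : ν ≤ 1 :=
    Real.rpow_le_one_of_one_le_of_nonpos (by exact_mod_cast hnpos) (by
      have : (0 : ℝ) ≤ 1 / (d : ℝ) := by positivity
      linarith)
  have hxc : cK ≤ h x := hK' x (Metric.closedBall_subset_closedBall (le_max_left _ _) (hρ hxK))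
  have hx0 : 0 < h x := hcK.trans_le hxc
  set D := Metric.infDist x (α n : Set E) with hD
  have hD0 : 0 ≤ D := Metric.infDist_nonneg
  rcases hD0.eq_or_lt with hD00 | hDpos
  · rw [← hD00]; positivity
  have hDs : D / 4 < s₀ := by
    by_contra! hfar
    have h1 := hmicro n hn1 ν hν0 hνd x hxM s hs0 (by linarith) (by linarith)
    have h2 : η ≤ q * D ^ r * (c * h x * s ^ d) := by
      have : (4 * s) ^ r ≤ D ^ r := Real.rpow_le_rpow (by positivity) (by linarith) hr.le
      rw [hη]; gcongr
    have h3 : C * ν ^ p ≤ C * ν ^ d := by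
      rw [hp, Real.rpow_add hν0, Real.rpow_natCast]
      have : ν ^ r ≤ 1 := Real.rpow_le_one hν0.le hν1 hr.le
      refine mul_le_mul_of_nonneg_left ?_ hC.le
      exact mul_le_of_le_one_left (by positivity) this
    have h5 : C < n * η := (div_lt_iff₀ hη0).1 hn2
    have h6 : 0 < ν ^ d := by positivity
    have h7 : η ≤ C * ν ^ d := (h2.trans h1).trans h3
    have h8 : ν ^ d * C < ν ^ d * (n * η) := by gcongr
    have h9 : ν ^ d * (n * η) = η := by rw [← mul_assoc, hνd, one_mul]
    linarith
  have hfinal := hmicro n hn1 ν hν0 hνd x hxM (D / 4) (by positivity) hDs le_rfl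
  have hDp : D ^ p ≤ B * ν ^ p * (h x)⁻¹ := by
    have h1 : D ^ p = D ^ r * D ^ d := by rw [hp, Real.rpow_add hDpos, Real.rpow_natCast]
    rw [h1, hB, ← div_eq_mul_inv, le_div_iff₀ hx0, div_mul_eq_mul_div, le_div_iff₀ (by positivity)]
    rw [div_pow] at hfinal
    have h4 : (0 : ℝ) < 4 ^ d := by positivity
    calc D ^ r * D ^ d * h x * (q * c)
        = q * D ^ r * (c * h x * (D ^ d / 4 ^ d)) * 4 ^ d := by field_simp
      _ ≤ C * ν ^ p * 4 ^ d := by gcongr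
      _ = _ := by ring
  calc D = (D ^ p) ^ p⁻¹ := (Real.rpow_rpow_inv hD0 hp0.ne').symm
    _ ≤ (B * ν ^ p * (h x)⁻¹) ^ p⁻¹ := Real.rpow_le_rpow (by positivity) hDp (by positivity)
    _ = B ^ p⁻¹ * ν * h x ^ (-(1 / p)) := by
        rw [Real.mul_rpow (by positivity) (by positivity),
          Real.mul_rpow (by positivity) (by positivity), Real.rpow_rpow_inv hν0.le hp0.ne',
          Real.rpow_neg hx0.le, one_div, Real.inv_rpow hx0.le]

/-- `E` is `ℝ^d`, `d ≥ 1`, with an arbitrary norm, and `lam` its Lebesgue measure. -/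
theorem proposition4p4 {E : Type*} [NormedAddCommGroup E] [NormedSpace ℝ E]
    [FiniteDimensional ℝ E] [Nontrivial E] [MeasurableSpace E] [BorelSpace E]
    (lam : Measure E) [lam.IsAddHaarMeasure]
    (P : Measure E) [IsProbabilityMeasure P] (h : E → ℝ)
    (r : ℝ) (hr : 0 < r)
    (hmoment : ∃ δ : ℝ, 0 < δ ∧ Integrable (fun x : E => ‖x‖ ^ (r + δ)) P)
    (α : ℕ → Finset E) (hα : ∀ n : ℕ, 1 ≤ n → IsOptimalCodebook P r n (α n))
    (R : ℝ) (hR : 0 < R) (hP : PeaklessSublevelTail lam P h R) :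
    ∃ c : ℝ, 0 < c ∧ ∀ K : Set E, IsCompact K → ∃ nK : ℕ, ∀ n : ℕ, nK ≤ n →
      (∀ᵐ x ∂lam, x ∈ K →
        Metric.infDist x (α n : Set E) ≤
          c * (n : ℝ) ^ (-(1 / (Module.finrank ℝ E : ℝ))) *
            h x ^ (-(1 / (r + (Module.finrank ℝ E : ℝ))))) ∧
      ((∃ M : ℝ, ∀ x ∈ Metric.closedBall (0 : E) R, h x ≤ M) →
        ∀ x ∈ K,
          Metric.infDist x (α n : Set E) ≤
            c * (n : ℝ) ^ (-(1 / (Module.finrank ℝ E : ℝ))) *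
              h x ^ (-(1 / (r + (Module.finrank ℝ E : ℝ))))) := by
  obtain ⟨δ, hδ, hint⟩ := hmoment
  obtain ⟨M₀, hM₀⟩ := hP.ess_bounded
  have hM₀' : ∀ᵐ x ∂lam, h x ≤ M₀ := hM₀.mono fun x hx => (le_abs_self _).trans hx
  -- The constant must be fixed before boundedness on the ball is assumed, so one `M` has to serve
  -- both claims; if `h` is unbounded above there, the second is vacuous.
  obtain ⟨M, hM, hhM, hball⟩ : ∃ M : ℝ, 0 < M ∧ (∀ᵐ x ∂lam, h x ≤ M) ∧
      ((∃ M : ℝ, ∀ x ∈ Metric.closedBall (0 : E) R, h x ≤ M) → ∀ x, h x ≤ M) := by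
    by_cases hb : ∃ M : ℝ, ∀ x ∈ Metric.closedBall (0 : E) R, h x ≤ M
    · obtain ⟨M₁, hM₁⟩ := hb
      refine ⟨max 1 (max M₀ M₁), by positivity, hM₀'.mono fun x hx => ?_, fun _ x => ?_⟩
      · exact hx.trans ((le_max_left _ _).trans (le_max_right _ _))
      · by_cases hx : x ∈ Metric.closedBall (0 : E) R
        · exact (hM₁ x hx).trans ((le_max_right _ _).trans (le_max_right _ _))
        · exact (hP.le_of_notMem_closedBall hM₀' hx).trans
            ((le_max_left _ _).trans (le_max_right _ _))
    · exact ⟨max 1 M₀, by positivity, hM₀'.mono fun x hx => hx.trans (le_max_right _ _),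
        fun hb' => absurd hb' hb⟩
  obtain ⟨c, hc, hmain⟩ := hP.infDist_le hr hδ hint hα hR hM hhM
  refine ⟨c, hc, fun K hK => ?_⟩
  obtain ⟨nK, hnK⟩ := hmain K hK
  refine ⟨nK, fun n hn => ⟨?_, fun hb x hx => hnK n hn x hx (hball hb x)⟩⟩
  filter_upwards [hhM] with x hx hxK using hnK n hn x hxK hx
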